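/- Let $\mathcal P_2(\mathbb R^d)$ be the set of Borel probability measures on $\mathbb R^d$ with finite second moment. An optimal map from $\nu$ to $\mu$ is a measurable map $T:\mathbb R^d\to\mathbb R^d$ with $T_\sharp\nu=\mu$ that minimizes $\int\|x-T(x)\|_2^2\,d\nu(x)$ among all measurable maps pushing $\nu$ forward to $\mu$. Let $\nu,\mu_1,\dots,\mu_m\in\mathcal P_2(\mathbb R^d)$, where $\nu$ has a density with respect to Lebesgue measure, and let $a\in\Delta_{m-1}=\{a\in\mathbb R_{\ge 0}^m:\sum_i a_i=1\}$. For each $\mu\in\{\nu,\mu_1,\dots,\mu_m\}$ there is an optimal map from $\nu$ to $\mu$, unique up to $\nu$-a.e. equality. Let $T_i^*$ be the optimal map from $\nu$ to $\mu_i$, and let $\rho_a^G=\bigl(\sum_{i=1}^m a_iT_i^*\bigr)_\sharp\nu$ be the generalized geodesic with base $\nu$. Then $\rho_a^G\in\mathcal P_2(\mathbb R^d)$, the map $\sum_{i=1}^m a_iT_i^*$ is an optimal map from $\nu$ to $\rho_a^G$, unique up to $\nu$-a.e. equality, and $$W_{2,\nu}^2(\rho^G_a,\nu)=\sum_{i=1}^m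 a_iW_{2,\nu}^2(\mu_i,\nu)-\frac12\sum_{i\neq j}a_ia_jW_{2,\nu}^2(\mu_i,\mu_j),$$ where the last sum runs over ordered pairs $(i,j)$ with $i\ne j$, and, for measures $\mu,\mu'$ to which the optimal maps $T_\mu,T_{\mu'}$ from $\nu$ exist and are $\nu$-a.e. unique, $W_{2,\nu}(\mu,\mu')=\bigl(\int\|T_\mu(x)-T_{\mu'}(x)\|_2^2\,d\nu(x)\bigr)^{1/2}$. -/

import Mathlib

open MeasureTheory
open scoped ENNReal

/-- Membership in the space of probability distributions on `ℝ^d` with finite second moment. -/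
structure InP2 {d : ℕ} (μ : Measure (EuclideanSpace ℝ (Fin d))) : Prop where
  isProbabilityMeasure : IsProbabilityMeasure μ
  memLp_two : MemLp (fun x => x) 2 μ

/-- The quadratic cost `∫ ‖x - T x‖² dν(x)` of a map, as an extended nonnegative real. -/
noncomputable def mongeCost {d : ℕ} (ν : Measure (EuclideanSpace ℝ (Fin d)))
    (T : EuclideanSpace ℝ (Fin d) → EuclideanSpace ℝ (Fin d)) : ℝ≥0∞ :=
  ∫⁻ x, ‖x - T x‖ₑ ^ 2 ∂ν

/-- `T` is an optimal map from `ν` to `μ`: it solves the Monge problem, that is, it pushes `ν`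
forward to `μ` and has the least cost among all maps which do so. -/
structure IsOptimalMap {d : ℕ} (ν μ : Measure (EuclideanSpace ℝ (Fin d)))
    (T : EuclideanSpace ℝ (Fin d) → EuclideanSpace ℝ (Fin d)) : Prop where
  measurable : Measurable T
  map_eq : ν.map T = μ
  cost_le : ∀ S : EuclideanSpace ℝ (Fin d) → EuclideanSpace ℝ (Fin d),
    Measurable S → ν.map S = μ → mongeCost ν T ≤ mongeCost ν S

/-- There is an optimal map from `ν` to `μ`, and any two of them agree `ν`-almost everywhere. -/
def HasUniqueOptimalMap {d : ℕ} (ν μ : Measure (EuclideanSpace ℝ (Fin d))) : Prop :=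
  (∃ T, IsOptimalMap ν μ T) ∧
    ∀ T S, IsOptimalMap ν μ T → IsOptimalMap ν μ S → T =ᵐ[ν] S

/-- The optimal map from `ν` to `μ` (an arbitrary map if no optimal map exists). -/
noncomputable def optimalMap {d : ℕ} (ν μ : Measure (EuclideanSpace ℝ (Fin d))) :
    EuclideanSpace ℝ (Fin d) → EuclideanSpace ℝ (Fin d) :=
  Classical.epsilon (IsOptimalMap ν μ)

/-- The `(2,ν)`-transport metric
`W_{2,ν}(μ₁, μ₂) = (∫ ‖T₁ x - T₂ x‖² dν(x))^{1/2}`, with `Tᵢ` the optimal map from `ν` to `μᵢ`. -/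
noncomputable def transportMetric {d : ℕ} (ν μ₁ μ₂ : Measure (EuclideanSpace ℝ (Fin d))) : ℝ :=
  Real.sqrt (∫ x, ‖optimalMap ν μ₁ x - optimalMap ν μ₂ x‖ ^ 2 ∂ν)

/-- The convex combination `∑ i, a i • T i` of the optimal maps `T i` from `ν` to `μ i`. -/
noncomputable def combinedMap {d m : ℕ} (ν : Measure (EuclideanSpace ℝ (Fin d)))
    (μ : Fin m → Measure (EuclideanSpace ℝ (Fin d))) (a : Fin m → ℝ) :
    EuclideanSpace ℝ (Fin d) → EuclideanSpace ℝ (Fin d) :=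
  fun x => ∑ i, a i • optimalMap ν (μ i) x

/-- The generalized geodesic of `μ 1, …, μ m` with base `ν`, at the parameter `a`. -/
noncomputable def generalizedGeodesic {d m : ℕ} (ν : Measure (EuclideanSpace ℝ (Fin d)))
    (μ : Fin m → Measure (EuclideanSpace ℝ (Fin d))) (a : Fin m → ℝ) :
    Measure (EuclideanSpace ℝ (Fin d)) :=
  ν.map (combinedMap ν μ a)

open Set Filter Topology
open scoped NNReal RealInnerProductSpace

/-! For `ν ≪ volume` and finite second moments, a map is optimal onto its image exactly when its
graph is cyclically monotone off a `ν`-null set. The defining inequalities are linear in the values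
of the map, so they survive nonnegative combinations, on the intersection of the full-measure sets
(`CyclicallyMonotone.sum_smul`). Hence `∑ i, a i • T i` is optimal onto its own image, and the
distance formula is the integral of a pointwise Hilbert-space identity (`norm_sum_smul_sq`).

Necessity: rearranging mass near a cycle of support points cannot lower the cost of an optimal plan
(`IsOptimalPlan.cyclicallyMonotone_support`). Sufficiency: Rockafellar's theorem supplies a convex
potential, which with its conjugate certifies optimality by duality
(`CyclicallyMonotone.integral_inner_le`).

Existence and uniqueness are Brenier's theorem: an optimal plan exists by compactness, its support
lies in the subdifferential of a convex function, and almost everywhere differentiability makes the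
plan a graph. -/

/-- A measure on the product with prescribed marginals. -/
structure IsCoupling {X Y : Type*} [MeasurableSpace X] [MeasurableSpace Y]
    (ν : Measure X) (μ : Measure Y) (π : Measure (X × Y)) : Prop where
  fst_eq : π.fst = ν
  snd_eq : π.snd = μ

/-- The quadratic cost of a transport plan. -/
noncomputable def planCost {E : Type*} [NormedAddCommGroup E] [MeasurableSpace E]
    (π : Measure (E × E)) : ℝ≥0∞ :=
  ∫⁻ p, ‖p.1 - p.2‖ₑ ^ 2 ∂π

/-- A coupling of least quadratic cost. -/
structure IsOptimalPlan {E : Type*} [NormedAddCommGroup E] [MeasurableSpace E]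
    (ν μ : Measure E) (π : Measure (E × E)) : Prop extends IsCoupling ν μ π where
  cost_le : ∀ π', IsCoupling ν μ π' → planCost π ≤ planCost π'

/-- Cyclical monotonicity of a subset of `E × E`. -/
def CyclicallyMonotone {E : Type*} [NormedAddCommGroup E] [InnerProductSpace ℝ E]
    (Γ : Set (E × E)) : Prop :=
  ∀ (n : ℕ) (p : ℕ → E × E), (∀ i, p i ∈ Γ) →
    ∑ i ∈ Finset.range n, ⟪(p i).2, (p (i + 1)).1 - (p i).1⟫
      + ⟪(p n).2, (p 0).1 - (p n).1⟫ ≤ 0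

/-! ### Couplings, quadratic cost and existence of optimal plans -/

section Coupling

variable {X Y : Type*} [MeasurableSpace X] [MeasurableSpace Y]
  {ν : Measure X} {μ : Measure Y} {π : Measure (X × Y)}

theorem IsCoupling.isProbabilityMeasure [IsProbabilityMeasure ν] (h : IsCoupling ν μ π) :
    IsProbabilityMeasure π :=
  ⟨by rw [← Measure.fst_univ, h.fst_eq, measure_univ]⟩

theorem isCoupling_prod [IsProbabilityMeasure ν] [IsProbabilityMeasure μ] :
    IsCoupling ν μ (ν.prod μ) :=
  ⟨Measure.fst_prod, Measure.snd_prod⟩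

theorem isCoupling_graph {T : X → Y} (hT : Measurable T) (h : ν.map T = μ) :
    IsCoupling ν μ (ν.map fun x => (x, T x)) := by
  refine ⟨?_, ?_⟩
  · rw [Measure.fst, Measure.map_map measurable_fst (by fun_prop)]
    exact Measure.map_id
  · rw [Measure.snd, Measure.map_map measurable_snd (by fun_prop)]
    exact h

end Coupling

section PlanCost

variable {E : Type*} [NormedAddCommGroup E]

theorem lintegral_enorm_sq_lt_top {X : Type*} [MeasurableSpace X] {ν : Measure X} {f : X → E}
    (hf : MemLp f 2 ν) : ∫⁻ x, ‖f x‖ₑ ^ 2 ∂ν < ∞ := by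
  have := lintegral_rpow_enorm_lt_top_of_eLpNorm_lt_top (by norm_num) (by norm_num) hf.2
  simpa using this

variable [MeasurableSpace E]

theorem planCost_add (π π' : Measure (E × E)) :
    planCost (π + π') = planCost π + planCost π' :=
  lintegral_add_measure _ _ _

theorem planCost_smul (c : ℝ≥0∞) (π : Measure (E × E)) :
    planCost (c • π) = c * planCost π :=
  lintegral_smul_measure _ _

theorem planCost_sum {ι : Type*} (s : Finset ι) (π : ι → Measure (E × E)) :
    planCost (∑ i ∈ s, π i) = ∑ i ∈ s, planCost (π i) :=
  lintegral_finsetSum_measure _ _ _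

variable [BorelSpace E] [SecondCountableTopology E]

theorem measurable_enorm_sub_sq : Measurable fun p : E × E => ‖p.1 - p.2‖ₑ ^ 2 := by
  fun_prop

theorem planCost_graph {ν : Measure E} {T : E → E} (hT : Measurable T) :
    planCost (ν.map fun x => (x, T x)) = ∫⁻ x, ‖x - T x‖ₑ ^ 2 ∂ν := by
  rw [planCost, lintegral_map measurable_enorm_sub_sq (by fun_prop)]

theorem IsCoupling.planCost_lt_top {ν μ : Measure E} {π : Measure (E × E)}
    (h : IsCoupling ν μ π) (hν : MemLp (fun x => x) 2 ν) (hμ : MemLp (fun x => x) 2 μ) :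
    planCost π < ∞ := by
  have h1 : MemLp (fun p : E × E => p.1) 2 π := by
    have := h.fst_eq ▸ hν
    exact (memLp_map_measure_iff aestronglyMeasurable_id measurable_fst.aemeasurable).1 this
  have h2 : MemLp (fun p : E × E => p.2) 2 π := by
    have := h.snd_eq ▸ hμ
    exact (memLp_map_measure_iff aestronglyMeasurable_id measurable_snd.aemeasurable).1 this
  exact lintegral_enorm_sq_lt_top (h1.sub h2)

/-- Truncating the cost at `n` gives bounded continuous integrands, whose integrals are weakly
continuous; by monotone convergence the full cost is their supremum. -/
theorem lowerSemicontinuous_planCost :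
    LowerSemicontinuous fun π : ProbabilityMeasure (E × E) => planCost (π : Measure (E × E)) := by
  have hcont : ∀ n : ℕ, Continuous fun p : E × E => min (‖p.1 - p.2‖₊ ^ 2) (n : ℝ≥0) :=
    fun n => Continuous.min (by fun_prop) continuous_const
  let f : ℕ → BoundedContinuousFunction (E × E) ℝ≥0 := fun n =>
    BoundedContinuousFunction.mkOfBound ⟨_, hcont n⟩ n fun p q => by
      have h : ∀ p : E × E, ((min (‖p.1 - p.2‖₊ ^ 2) (n : ℝ≥0) : ℝ≥0) : ℝ) ≤ n := fun p =>
        NNReal.coe_le_coe.2 (min_le_right _ _)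
      rw [NNReal.dist_eq, abs_sub_le_iff]
      constructor
      · exact (sub_le_self _ (NNReal.coe_nonneg _)).trans (h p)
      · exact (sub_le_self _ (NNReal.coe_nonneg _)).trans (h q)
  have hf : ∀ n p, f n p = min (‖p.1 - p.2‖₊ ^ 2) (n : ℝ≥0) := fun _ _ => rfl
  have key : ∀ π : ProbabilityMeasure (E × E),
      planCost (π : Measure (E × E)) = ⨆ n, ∫⁻ p, f n p ∂(π : Measure (E × E)) := by
    intro π
    rw [← lintegral_iSup]
    · unfold planCost
      congr 1 with p
      refine le_antisymm ?_ (iSup_le fun n => ?_)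
      · obtain ⟨n, hn⟩ := exists_nat_ge (‖p.1 - p.2‖₊ ^ 2)
        refine le_iSup_of_le n ?_
        rw [hf, min_eq_left hn]
        simp [enorm]
      · rw [hf]
        refine (ENNReal.coe_le_coe.2 (min_le_left _ _)).trans ?_
        simp [enorm]
    · intro n
      exact (f n).continuous.measurable.coe_nnreal_ennreal
    · intro n k hnk p
      simp only [hf]
      gcongr
  simp_rw [key]
  exact lowerSemicontinuous_iSup fun n =>
    (ProbabilityMeasure.continuous_lintegral_boundedContinuousFunction (f n)).lowerSemicontinuous

end PlanCost

/-- Direct method: the couplings are weakly closed, and tight because their marginals are fixed,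
hence compact by Prokhorov; a lower semicontinuous cost attains its minimum there. -/
theorem exists_isOptimalPlan {E : Type*} [NormedAddCommGroup E] [MeasurableSpace E] [BorelSpace E]
    [SecondCountableTopology E] [CompleteSpace E] (ν μ : Measure E) [IsProbabilityMeasure ν]
    [IsProbabilityMeasure μ] : ∃ π, IsOptimalPlan ν μ π := by
  let K : Set (ProbabilityMeasure (E × E)) := {π | IsCoupling ν μ (π : Measure (E × E))}
  have hK_closed : IsClosed K := by
    have h1 : Continuous fun π : ProbabilityMeasure (E × E) =>
      π.map continuous_fst.measurable.aemeasurable :=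
        ProbabilityMeasure.continuous_map continuous_fst
    have h2 : Continuous fun π : ProbabilityMeasure (E × E) =>
      π.map continuous_snd.measurable.aemeasurable :=
        ProbabilityMeasure.continuous_map continuous_snd
    have : K = {π : ProbabilityMeasure (E × E) |
          π.map continuous_fst.measurable.aemeasurable = (⟨ν, inferInstance⟩ : ProbabilityMeasure E)} ∩
        {π : ProbabilityMeasure (E × E) |
          π.map continuous_snd.measurable.aemeasurable = (⟨μ, inferInstance⟩ : ProbabilityMeasure E)} := by
      ext π
      constructor
      · intro h
        exact ⟨Subtype.ext h.fst_eq, Subtype.ext h.snd_eq⟩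
      · intro h
        exact ⟨congrArg Subtype.val h.1, congrArg Subtype.val h.2⟩
    rw [this]
    exact (isClosed_eq h1 continuous_const).inter (isClosed_eq h2 continuous_const)
  have hK_tight : IsTightMeasureSet {((π : ProbabilityMeasure (E × E)) : Measure (E × E)) | π ∈ K} := by
    refine IsTightMeasureSet.prodMk ((isTightMeasureSet_singleton (μ := ν)).subset ?_)
      ((isTightMeasureSet_singleton (μ := μ)).subset ?_)
    · rintro _ ⟨_, ⟨π, hπ, rfl⟩, rfl⟩
      exact hπ.fst_eq
    · rintro _ ⟨_, ⟨π, hπ, rfl⟩, rfl⟩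
      exact hπ.snd_eq
  have hK : IsCompact K := by
    have := isCompact_closure_of_isTightMeasureSet hK_tight
    rwa [hK_closed.closure_eq] at this
  obtain ⟨π, hπ, hmin⟩ := LowerSemicontinuousOn.exists_isMinOn
    (s := K) ⟨⟨ν.prod μ, inferInstance⟩, isCoupling_prod⟩ hK
    ((lowerSemicontinuous_planCost (E := E)).lowerSemicontinuousOn K)
  refine ⟨π, hπ, fun π' hπ' => ?_⟩
  have := hπ'.isProbabilityMeasure
  exact hmin (show (⟨π', this⟩ : ProbabilityMeasure (E × E)) ∈ K from hπ')

/-! ### Cyclical monotonicity of the support of an optimal plan -/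

theorem eventually_forall_mem_ball {X : Type*} [PseudoMetricSpace X] {q : X} {P : X → Prop}
    (h : ∀ᶠ z in 𝓝 q, P z) : ∀ᶠ δ in 𝓝[>] (0 : ℝ), ∀ z ∈ Metric.ball q δ, P z := by
  obtain ⟨ε, hε, h⟩ := Metric.eventually_nhds_iff_ball.1 h
  filter_upwards [Ioo_mem_nhdsGT hε] with δ hδ z hz
  exact h z (Metric.ball_subset_ball hδ.2.le hz)

theorem ENNReal.ofReal_sum_le {ι : Type*} (s : Finset ι) (f : ι → ℝ) :
    ENNReal.ofReal (∑ i ∈ s, f i) ≤ ∑ i ∈ s, ENNReal.ofReal (f i) := by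
  classical
  induction s using Finset.induction_on with
  | empty => simp
  | insert a s ha ih =>
    rw [Finset.sum_insert ha, Finset.sum_insert ha]
    exact ENNReal.ofReal_add_le.trans (by gcongr)

theorem MeasureTheory.Measure.fst_finsetSum {X Y ι : Type*} [MeasurableSpace X]
    [MeasurableSpace Y] (s : Finset ι) (π : ι → Measure (X × Y)) :
    (∑ i ∈ s, π i).fst = ∑ i ∈ s, (π i).fst := by
  ext t ht
  simp [Measure.fst_apply ht, Measure.finsetSum_apply]

theorem MeasureTheory.Measure.snd_finsetSum {X Y ι : Type*} [MeasurableSpace X]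
    [MeasurableSpace Y] (s : Finset ι) (π : ι → Measure (X × Y)) :
    (∑ i ∈ s, π i).snd = ∑ i ∈ s, (π i).snd := by
  ext t ht
  simp [Measure.snd_apply ht, Measure.finsetSum_apply]

section

variable {E : Type*} [NormedAddCommGroup E] [MeasurableSpace E]

/-- Replacing the part `c • κ` of `π` by `c • κ'` yields a competing coupling; the finite cost of
the untouched remainder cancels. -/
theorem IsOptimalPlan.planCost_le_of_smul_le {ν μ : Measure E} {π κ κ' : Measure (E × E)}
    (h : IsOptimalPlan ν μ π) (hfin : planCost π ≠ ∞) {c : ℝ≥0∞} (hc : c ≠ 0) (hc' : c ≠ ∞)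
    [IsFiniteMeasure κ] (hκ : c • κ ≤ π) (hfst : κ'.fst = κ.fst) (hsnd : κ'.snd = κ.snd) :
    planCost κ ≤ planCost κ' := by
  have : IsFiniteMeasure (c • κ) := Measure.smul_finite κ hc'
  have hπ : π - c • κ + c • κ = π := Measure.sub_add_cancel_of_le hκ
  have hcoup : IsCoupling ν μ (π - c • κ + c • κ') := by
    constructor
    · rw [← h.fst_eq]
      conv_rhs => rw [← hπ]
      simp only [Measure.fst, Measure.map_add _ _ measurable_fst, Measure.map_smul] at hfst ⊢
      rw [hfst]
    · rw [← h.snd_eq]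
      conv_rhs => rw [← hπ]
      simp only [Measure.snd, Measure.map_add _ _ measurable_snd, Measure.map_smul] at hsnd ⊢
      rw [hsnd]
  have hle := h.cost_le _ hcoup
  have h0 : planCost (π - c • κ) ≠ ∞ :=
    ne_top_of_le_ne_top hfin (lintegral_mono' Measure.sub_le le_rfl)
  conv_lhs at hle => rw [← hπ]
  rw [planCost_add, planCost_add, planCost_smul, planCost_smul,
    ENNReal.add_le_add_iff_left h0] at hle
  exact (ENNReal.mul_le_mul_iff_right hc hc').1 hle

theorem ofReal_le_planCost {κ : Measure (E × E)} [IsProbabilityMeasure κ] {r : ℝ}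
    (h : ∀ᵐ p ∂κ, r ≤ ‖p.1 - p.2‖ ^ 2) : ENNReal.ofReal r ≤ planCost κ := by
  calc ENNReal.ofReal r = ∫⁻ _, ENNReal.ofReal r ∂κ := by simp
    _ ≤ planCost κ := by
      refine lintegral_mono_ae ?_
      filter_upwards [h] with p hp
      calc ENNReal.ofReal r ≤ ENNReal.ofReal (‖p.1 - p.2‖ ^ 2) := ENNReal.ofReal_le_ofReal hp
        _ = _ := by rw [ENNReal.ofReal_pow (norm_nonneg _), ofReal_norm]

theorem planCost_le_ofReal {κ : Measure (E × E)} [IsProbabilityMeasure κ] {r : ℝ}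
    (h : ∀ᵐ p ∂κ, ‖p.1 - p.2‖ ^ 2 ≤ r) : planCost κ ≤ ENNReal.ofReal r := by
  calc planCost κ ≤ ∫⁻ _, ENNReal.ofReal r ∂κ := by
        refine lintegral_mono_ae ?_
        filter_upwards [h] with p hp
        calc _ = ENNReal.ofReal (‖p.1 - p.2‖ ^ 2) := by
              rw [ENNReal.ofReal_pow (norm_nonneg _), ofReal_norm]
          _ ≤ _ := ENNReal.ofReal_le_ofReal hp
    _ = ENNReal.ofReal r := by simp

variable [BorelSpace E] [SecondCountableTopology E]

-- Were the inequality false, mass near the points `q i` could be rerouted along `σ` at lower cost.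
-- Since single points may be null, small balls around them are used, with an error `ε` that tends
-- to zero.
open ProbabilityTheory in
theorem IsOptimalPlan.sum_sq_norm_sub_le {ν μ : Measure E} {π : Measure (E × E)}
    [IsProbabilityMeasure π] (h : IsOptimalPlan ν μ π) (hfin : planCost π ≠ ∞)
    {ι : Type*} [Fintype ι] [Nonempty ι] (q : ι → E × E) (hq : ∀ i, q i ∈ π.support)
    (σ : Equiv.Perm ι) :
    ∑ i, ‖(q i).1 - (q i).2‖ ^ 2 ≤ ∑ i, ‖(q (σ i)).1 - (q i).2‖ ^ 2 := by
  suffices H : ∀ ε : ℝ, 0 < ε → ∑ i, (‖(q i).1 - (q i).2‖ ^ 2 - ε) ≤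
      ∑ i, (‖(q (σ i)).1 - (q i).2‖ ^ 2 + ε) by
    have hlim1 : Tendsto (fun ε : ℝ => ∑ i, (‖(q i).1 - (q i).2‖ ^ 2 - ε)) (𝓝[>] 0)
        (𝓝 (∑ i, (‖(q i).1 - (q i).2‖ ^ 2 - 0))) :=
      (Continuous.tendsto (by fun_prop) 0).mono_left nhdsWithin_le_nhds
    have hlim2 : Tendsto (fun ε : ℝ => ∑ i, (‖(q (σ i)).1 - (q i).2‖ ^ 2 + ε)) (𝓝[>] 0)
        (𝓝 (∑ i, (‖(q (σ i)).1 - (q i).2‖ ^ 2 + 0))) :=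
      (Continuous.tendsto (by fun_prop) 0).mono_left nhdsWithin_le_nhds
    simpa using le_of_tendsto_of_tendsto hlim1 hlim2
      (eventually_nhdsWithin_of_forall fun ε hε => H ε hε)
  intro ε hε
  have hcont : Continuous fun p : E × E => ‖p.1 - p.2‖ ^ 2 := by fun_prop
  obtain ⟨δ, ⟨hδ1, hδ2⟩, hδ0⟩ : ∃ δ : ℝ,
      ((∀ i, ∀ z ∈ Metric.ball (q i) δ,
        ‖(q i).1 - (q i).2‖ ^ 2 - ε ≤ ‖z.1 - z.2‖ ^ 2) ∧
      ∀ i, ∀ z ∈ Metric.ball ((q (σ i)).1, (q i).2) δ,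
        ‖z.1 - z.2‖ ^ 2 ≤ ‖(q (σ i)).1 - (q i).2‖ ^ 2 + ε) ∧ δ ∈ Ioi (0 : ℝ) := by
    refine (Eventually.and (Eventually.and ?_ ?_)
      (self_mem_nhdsWithin : Ioi (0 : ℝ) ∈ 𝓝[>] 0)).exists
    · refine eventually_all.2 fun i => eventually_forall_mem_ball ?_
      exact (hcont.tendsto (q i)).eventually_const_le (sub_lt_self _ hε)
    · refine eventually_all.2 fun i => eventually_forall_mem_ball ?_
      exact (hcont.tendsto ((q (σ i)).1, (q i).2)).eventually_le_const (lt_add_of_pos_right _ hε)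
  let B : ι → Set (E × E) := fun i => Metric.ball (q i) δ
  have hB : ∀ i, π (B i) ≠ 0 := fun i =>
    ((Measure.mem_support_iff_forall _).1 (hq i) _ (Metric.ball_mem_nhds _ hδ0)).ne'
  have hBm : ∀ i, MeasurableSet (B i) := fun i => Metric.isOpen_ball.measurableSet
  have hprob : ∀ i, IsProbabilityMeasure (cond π (B i)) := fun i =>
    cond_isProbabilityMeasure (hB i)
  have hmem : ∀ i, ∀ᵐ p ∂(cond π (B i)), p ∈ B i := fun i => ae_cond_mem (hBm i)
  have hfst : ∀ i, ∀ᵐ x ∂(cond π (B i)).fst, x ∈ Metric.ball (q i).1 δ := fun i => by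
    refine (ae_map_iff measurable_fst.aemeasurable Metric.isOpen_ball.measurableSet).2 ?_
    filter_upwards [hmem i] with p hp
    exact (le_max_left _ _).trans_lt (show dist p (q i) < δ from hp)
  have hsnd : ∀ i, ∀ᵐ x ∂(cond π (B i)).snd, x ∈ Metric.ball (q i).2 δ := fun i => by
    refine (ae_map_iff measurable_snd.aemeasurable Metric.isOpen_ball.measurableSet).2 ?_
    filter_upwards [hmem i] with p hp
    exact (le_max_right _ _).trans_lt (show dist p (q i) < δ from hp)
  let κ : Measure (E × E) := ∑ i, cond π (B i)
  let κ' : Measure (E × E) := ∑ i, (cond π (B (σ i))).fst.prod (cond π (B i)).snd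
  -- Each `cond π (B i)` is at most `(π (B i))⁻¹ • π`, so this factor makes `c • κ ≤ π`, even if the
  -- balls overlap.
  let c : ℝ≥0∞ := (∑ i, (π (B i))⁻¹)⁻¹
  have hsum : ∑ i, (π (B i))⁻¹ ≠ ∞ :=
    ENNReal.sum_ne_top.2 fun i _ => ENNReal.inv_ne_top.2 (hB i)
  have hsum0 : ∑ i, (π (B i))⁻¹ ≠ 0 := by
    obtain ⟨i⟩ := ‹Nonempty ι›
    intro h0
    have := (Finset.sum_eq_zero_iff.1 h0) i (Finset.mem_univ i)
    exact measure_ne_top π (B i) (ENNReal.inv_eq_zero.1 this)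
  have hle : c • κ ≤ π := by
    calc c • κ ≤ c • ∑ i, (π (B i))⁻¹ • π := by
          refine Measure.le_iff.2 fun s hs => ?_
          simp only [κ, Measure.smul_apply, Measure.finsetSum_apply, smul_eq_mul,
            ProbabilityTheory.cond]
          gcongr with i
          exact Measure.restrict_le_self
      _ = π := by
          rw [← Finset.sum_smul, smul_smul, ENNReal.inv_mul_cancel hsum0 hsum, one_smul]
  have hκ : planCost κ ≤ planCost κ' := by
    refine h.planCost_le_of_smul_le hfin (ENNReal.inv_ne_zero.2 hsum) (ENNReal.inv_ne_top.2 hsum0)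
      hle ?_ ?_
    · simp only [κ, κ', Measure.fst_finsetSum, Measure.fst_prod]
      exact Equiv.sum_comp σ fun i => (cond π (B i)).fst
    · simp only [κ, κ', Measure.snd_finsetSum, Measure.snd_prod]
  have hlow : ENNReal.ofReal (∑ i, (‖(q i).1 - (q i).2‖ ^ 2 - ε)) ≤ planCost κ := by
    rw [planCost_sum]
    refine (ENNReal.ofReal_sum_le _ _).trans (Finset.sum_le_sum fun i _ => ?_)
    refine ofReal_le_planCost ?_
    filter_upwards [hmem i] with p hp using hδ1 i p hp
  have hup : planCost κ' ≤ ENNReal.ofReal (∑ i, (‖(q (σ i)).1 - (q i).2‖ ^ 2 + ε)) := by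
    rw [planCost_sum, ENNReal.ofReal_sum_of_nonneg fun i _ => by positivity]
    refine Finset.sum_le_sum fun i _ => planCost_le_ofReal ?_
    have h1 := Measure.quasiMeasurePreserving_fst (μ := (cond π (B (σ i))).fst)
      (ν := (cond π (B i)).snd) |>.ae (hfst (σ i))
    have h2 := Measure.quasiMeasurePreserving_snd (μ := (cond π (B (σ i))).fst)
      (ν := (cond π (B i)).snd) |>.ae (hsnd i)
    filter_upwards [h1, h2] with p hp1 hp2
    refine hδ2 i p ?_
    rw [← ball_prod_same]
    exact ⟨hp1, hp2⟩
  exact (ENNReal.ofReal_le_ofReal_iff (Finset.sum_nonneg fun i _ => by positivity)).1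
    (hlow.trans (hκ.trans hup))
end

/-- Take `σ` to be the cyclic shift and expand the squares: the norm terms cancel and only the inner
products remain. -/
theorem IsOptimalPlan.cyclicallyMonotone_support {E : Type*} [NormedAddCommGroup E]
    [InnerProductSpace ℝ E] [MeasurableSpace E] [BorelSpace E] [SecondCountableTopology E]
    {ν μ : Measure E} {π : Measure (E × E)} [IsProbabilityMeasure π] (h : IsOptimalPlan ν μ π)
    (hfin : planCost π ≠ ∞) : CyclicallyMonotone π.support := by
  intro n p hp
  have := h.sum_sq_norm_sub_le hfin (fun i : Fin (n + 1) => p i) (fun i => hp i) (finRotate (n + 1))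
  have hsq : ∀ i : Fin (n + 1), ‖(p (finRotate (n + 1) i)).1 - (p i).2‖ ^ 2 =
      ‖(p i).1 - (p i).2‖ ^ 2 + (‖(p (finRotate (n + 1) i)).1‖ ^ 2 - ‖(p i).1‖ ^ 2)
        - 2 * ⟪(p i).2, (p (finRotate (n + 1) i)).1 - (p i).1⟫ := fun i => by
    rw [@norm_sub_sq_real, @norm_sub_sq_real, inner_sub_right, real_inner_comm (p i).2,
      real_inner_comm (p i).2]
    ring
  have hperm : ∑ i : Fin (n + 1), ‖(p (finRotate (n + 1) i)).1‖ ^ 2 =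
      ∑ i : Fin (n + 1), ‖(p i).1‖ ^ 2 :=
    Equiv.sum_comp (finRotate (n + 1)) fun i : Fin (n + 1) => ‖(p i).1‖ ^ 2
  simp only [hsq, Finset.sum_sub_distrib, Finset.sum_add_distrib, hperm, ← Finset.mul_sum] at this
  rw [Fin.sum_univ_castSucc (fun i : Fin (n + 1) =>
    ⟪(p i).2, (p (finRotate (n + 1) i)).1 - (p i).1⟫)] at this
  simp only [finRotate_apply, Fin.val_last, Fin.val_castSucc,
    Fin.coeSucc_eq_succ, Fin.val_succ, Fin.val_zero, Fin.last_add_one] at this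
  rw [Finset.sum_range]
  linarith

/-! ### Measurability of uncountable suprema -/

/-- Both sides default to `0` for an unbounded family. Real suprema thus inherit measurability from
`EReal`, where suprema of continuous functions are lower semicontinuous even over uncountable index
sets. -/
theorem EReal.toReal_iSup_coe {ι : Type*} [Nonempty ι] (g : ι → ℝ) :
    (⨆ i, (g i : EReal)).toReal = ⨆ i, g i := by
  by_cases h : BddAbove (range g)
  · have : (⨆ i, (g i : EReal)) = ((⨆ i, g i : ℝ) : EReal) := by
      refine le_antisymm (iSup_le fun i => EReal.coe_le_coe_iff.2 (le_ciSup h i)) ?_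
      refine le_of_forall_lt fun c hc => ?_
      induction c with
      | bot =>
        obtain ⟨i⟩ := ‹Nonempty ι›
        exact (EReal.bot_lt_coe (g i)).trans_le (le_iSup (fun i => (g i : EReal)) i)
      | top => exact absurd hc not_top_lt
      | coe c =>
        obtain ⟨i, hi⟩ := exists_lt_of_lt_ciSup (EReal.coe_lt_coe_iff.1 hc)
        exact (EReal.coe_lt_coe_iff.2 hi).trans_le (le_iSup (fun i => (g i : EReal)) i)
    rw [this, EReal.toReal_coe]
  · have : (⨆ i, (g i : EReal)) = ⊤ := by
      refine (EReal.eq_top_iff_forall_lt _).2 fun y => ?_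
      obtain ⟨_, ⟨i, rfl⟩, hi⟩ := not_bddAbove_iff.1 h y
      exact (EReal.coe_lt_coe_iff.2 hi).trans_le (le_iSup (fun i => (g i : EReal)) i)
    rw [this, EReal.toReal_top, Real.iSup_of_not_bddAbove h]

theorem EReal.iSup_coe_lt_top_iff {ι : Type*} (g : ι → ℝ) :
    (⨆ i, (g i : EReal)) < ⊤ ↔ BddAbove (range g) := by
  constructor
  · intro h
    by_contra hb
    refine h.ne ((EReal.eq_top_iff_forall_lt _).2 fun y => ?_)
    obtain ⟨_, ⟨i, rfl⟩, hi⟩ := not_bddAbove_iff.1 hb y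
    exact (EReal.coe_lt_coe_iff.2 hi).trans_le (le_iSup (fun i => (g i : EReal)) i)
  · rintro ⟨B, hB⟩
    exact (iSup_le fun i => EReal.coe_le_coe_iff.2 (hB (mem_range_self i))).trans_lt
      (EReal.coe_lt_top B)

section

variable {X ι : Type*} [TopologicalSpace X] [MeasurableSpace X] [OpensMeasurableSpace X]
  {g : ι → X → ℝ}

theorem measurable_iSup_coe_ereal_of_continuous (hg : ∀ i, Continuous (g i)) :
    Measurable fun x => ⨆ i, (g i x : EReal) :=
  (lowerSemicontinuous_iSup fun i =>
    (continuous_coe_real_ereal.comp (hg i)).lowerSemicontinuous).measurable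

theorem measurable_iSup_of_continuous [Nonempty ι] (hg : ∀ i, Continuous (g i)) :
    Measurable fun x => ⨆ i, g i x := by
  simp_rw [← EReal.toReal_iSup_coe]
  exact (measurable_iSup_coe_ereal_of_continuous hg).ereal_toReal

theorem measurableSet_bddAbove_range_of_continuous (hg : ∀ i, Continuous (g i)) :
    MeasurableSet {x | BddAbove (range fun i => g i x)} := by
  simp_rw [← EReal.iSup_coe_lt_top_iff]
  exact measurableSet_lt (measurable_iSup_coe_ereal_of_continuous hg) measurable_const

end

/-! ### Convex potentials and Rockafellar's theorem -/

section

variable {E : Type*} [NormedAddCommGroup E] [InnerProductSpace ℝ E]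

/-- The domain of the supremum of a set of affine functions `z ↦ ⟪f.1, z⟫ + f.2`. -/
def affineSupDomain (A : Set (E × ℝ)) : Set E :=
  {z | BddAbove (range fun f : A => ⟪f.1.1, z⟫ + f.1.2)}

/-- The supremum of a set of affine functions `z ↦ ⟪f.1, z⟫ + f.2`. -/
noncomputable def affineSup (A : Set (E × ℝ)) (z : E) : ℝ :=
  ⨆ f : A, (⟪f.1.1, z⟫ + f.1.2)

theorem le_affineSup {A : Set (E × ℝ)} {z : E} (hz : z ∈ affineSupDomain A) {f : E × ℝ}
    (hf : f ∈ A) : ⟪f.1, z⟫ + f.2 ≤ affineSup A z :=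
  le_ciSup hz ⟨f, hf⟩

theorem convexOn_affineSup {A : Set (E × ℝ)} (hA : A.Nonempty) :
    ConvexOn ℝ (affineSupDomain A) (affineSup A) := by
  have : Nonempty A := hA.to_subtype
  have key : ∀ x ∈ affineSupDomain A, ∀ y ∈ affineSupDomain A, ∀ a b : ℝ, 0 ≤ a → 0 ≤ b →
      a + b = 1 → ∀ f : A, ⟪f.1.1, a • x + b • y⟫ + f.1.2 ≤
        a * affineSup A x + b * affineSup A y := by
    intro x hx y hy a b ha hb hab f
    have h1 := mul_le_mul_of_nonneg_left (le_affineSup hx f.2) ha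
    have h2 := mul_le_mul_of_nonneg_left (le_affineSup hy f.2) hb
    have h3 : f.1.2 = a * f.1.2 + b * f.1.2 := by rw [← add_mul, hab, one_mul]
    rw [inner_add_right, inner_smul_right, inner_smul_right, h3]
    linarith
  refine ⟨fun x hx y hy a b ha hb hab => ?_, fun x hx y hy a b ha hb hab => ?_⟩
  · exact ⟨_, forall_mem_range.2 (key x hx y hy a b ha hb hab)⟩
  · exact ciSup_le (key x hx y hy a b ha hb hab)

/-- **Rockafellar's theorem**: a cyclically monotone set lies in the graph of the subdifferential
of a supremum of affine functions. -/
theorem CyclicallyMonotone.exists_affineSup {Γ : Set (E × E)} (hΓ : CyclicallyMonotone Γ)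
    (hne : Γ.Nonempty) : ∃ A : Set (E × ℝ), A.Nonempty ∧
      (∀ p ∈ Γ, p.1 ∈ affineSupDomain A) ∧
      ∀ p ∈ Γ, ∀ z ∈ affineSupDomain A,
        affineSup A p.1 + ⟪p.2, z - p.1⟫ ≤ affineSup A z := by
  obtain ⟨p₀, hp₀⟩ := hne
  -- The affine functions obtained by summing increments along chains in `Γ` that start at `p₀`,
  -- with the last point free.
  let A : Set (E × ℝ) := {f | ∃ (n : ℕ) (p : ℕ → E × E), (∀ i, p i ∈ Γ) ∧ p 0 = p₀ ∧
    ∀ z, ⟪f.1, z⟫ + f.2 = ∑ i ∈ Finset.range n, ⟪(p i).2, (p (i + 1)).1 - (p i).1⟫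
      + ⟪(p n).2, z - (p n).1⟫}
  have hbase : (p₀.2, -⟪p₀.2, p₀.1⟫) ∈ A :=
    ⟨0, fun _ => p₀, fun _ => hp₀, rfl, fun z => by
      simp only [Finset.range_zero, Finset.sum_empty, inner_sub_right]; ring⟩
  -- Appending `q` to a chain stays in `A`. Closing the longer chain at `p₀` bounds the supremum at
  -- `q.1`; leaving its end `z` free gives the subgradient inequality.
  have hstep : ∀ f ∈ A, ∀ q ∈ Γ, (q.2, ⟪f.1, q.1⟫ + f.2 - ⟪q.2, q.1⟫) ∈ A := by
    rintro f ⟨n, p, hp, hp0, hf⟩ q hq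
    refine ⟨n + 1, fun i => if i ≤ n then p i else q, fun i => ?_, by simpa using hp0,
      fun z => ?_⟩
    · dsimp only
      split_ifs
      exacts [hp i, hq]
    · rw [Finset.sum_range_succ, Finset.sum_congr rfl (g := fun i =>
        ⟪(p i).2, (p (i + 1)).1 - (p i).1⟫)]
      · simp only [le_refl, if_true, if_neg (Nat.not_succ_le_self n), hf q.1, inner_sub_right]
        ring
      · intro i hi
        have := Finset.mem_range.1 hi
        dsimp only
        rw [if_pos this.le, if_pos (Nat.succ_le_of_lt this)]
  have hbound : ∀ f ∈ A, ⟪f.1, p₀.1⟫ + f.2 ≤ 0 := by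
    rintro f ⟨n, p, hp, hp0, hf⟩
    rw [hf, ← hp0]
    exact hΓ n p hp
  have hdom : ∀ p ∈ Γ, p.1 ∈ affineSupDomain A := by
    refine fun p hp => ⟨⟪p.2, p.1 - p₀.1⟫, forall_mem_range.2 fun f => ?_⟩
    have := hbound _ (hstep f.1 f.2 p hp)
    simp only [inner_sub_right] at this ⊢
    linarith
  refine ⟨A, ⟨_, hbase⟩, hdom, fun p hp z hz => ?_⟩
  have : Nonempty A := ⟨⟨_, hbase⟩⟩
  rw [← le_sub_iff_add_le]
  refine ciSup_le fun f => ?_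
  have := le_affineSup hz (hstep f.1 f.2 p hp)
  simp only [inner_sub_right] at this ⊢
  linarith

/-- Subtracting the supporting linear function leaves a local minimum at `x`, where the derivative
vanishes. -/
theorem gradient_eq_of_isSubgradient [CompleteSpace E] {φ : E → ℝ} {x y : E} {D : Set E}
    (hD : D ∈ 𝓝 x) (hφ : DifferentiableAt ℝ φ x)
    (h : ∀ z ∈ D, φ x + ⟪y, z - x⟫ ≤ φ z) : gradient φ x = y := by
  have hmin : IsLocalMin (fun z => φ z - innerSL ℝ y z) x := by
    filter_upwards [hD] with z hz
    have := h z hz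
    simp only [inner_sub_right, innerSL_apply_apply] at this ⊢
    linarith
  have hd := hφ.hasFDerivAt.sub (innerSL ℝ y).hasFDerivAt (x := x)
  have h0 := sub_eq_zero.1 (hmin.hasFDerivAt_eq_zero hd)
  rw [gradient, h0, LinearIsometryEquiv.symm_apply_eq]
  rfl

end

/-! ### Cyclically monotone sets as graphs almost everywhere -/

section

variable {E : Type*} [NormedAddCommGroup E] [InnerProductSpace ℝ E] [FiniteDimensional ℝ E]
  [MeasurableSpace E] [BorelSpace E]

/-- A convex function on a finite-dimensional space is differentiable almost everywhere in the
interior of its domain. -/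
theorem ConvexOn.ae_differentiableAt_of_mem_interior {F : Type*} [NormedAddCommGroup F]
    [NormedSpace ℝ F] [FiniteDimensional ℝ F] [MeasurableSpace F] [BorelSpace F]
    {D : Set F} {φ : F → ℝ} (hφ : ConvexOn ℝ D φ) (m : Measure F) [m.IsAddHaarMeasure] :
    ∀ᵐ x ∂m, x ∈ interior D → DifferentiableAt ℝ φ x := by
  -- Convex functions are locally Lipschitz in the interior, so Rademacher's theorem applies near
  -- each point.
  have hloc : ∀ x ∈ interior D, ∃ u ∈ 𝓝[interior D] x,
      m (u ∩ {z | ¬ (z ∈ interior D → DifferentiableAt ℝ φ z)}) = 0 := by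
    intro x hx
    obtain ⟨K, t, ht, hK⟩ := hφ.locallyLipschitzOn_interior hx
    rw [isOpen_interior.nhdsWithin_eq hx] at ht
    refine ⟨interior t, mem_nhdsWithin_of_mem_nhds (interior_mem_nhds.2 ht), ?_⟩
    have := (hK.mono interior_subset).ae_differentiableWithinAt_of_mem (μ := m)
    refine measure_mono_null ?_ (ae_iff.1 this)
    rintro z ⟨hzt, hz⟩ hzd
    refine hz fun _ => ?_
    exact (hzd hzt).differentiableAt (isOpen_interior.mem_nhds hzt)
  rw [ae_iff]
  have hsub : {z | ¬ (z ∈ interior D → DifferentiableAt ℝ φ z)} ⊆ interior D := by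
    intro z hz
    by_contra h
    exact hz fun h' => absurd h' h
  refine measure_null_of_locally_null _ fun x hx => ?_
  obtain ⟨u, hu, hu0⟩ := hloc x (hsub hx)
  exact ⟨u ∩ {z | ¬ (z ∈ interior D → DifferentiableAt ℝ φ z)},
    inter_mem (nhdsWithin_mono _ hsub hu) self_mem_nhdsWithin, hu0⟩

/-- Off a null set, a cyclically monotone set is contained in the graph of a measurable map. -/
theorem CyclicallyMonotone.exists_measurable_map {Γ : Set (E × E)} (hΓ : CyclicallyMonotone Γ)
    (m : Measure E) [m.IsAddHaarMeasure] :
    ∃ T : E → E, Measurable T ∧ ∀ᵐ x ∂m, ∀ y, (x, y) ∈ Γ → y = T x := by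
  rcases Γ.eq_empty_or_nonempty with rfl | hne
  · exact ⟨id, measurable_id, by simp⟩
  obtain ⟨A, hA, hdom, hsub⟩ := hΓ.exists_affineSup hne
  refine ⟨gradient (affineSup A), ?_, ?_⟩
  · exact (InnerProductSpace.toDual ℝ E).symm.continuous.measurable.comp (measurable_fderiv ℝ _)
  · have hconv := convexOn_affineSup hA
    -- The domain is convex, so its frontier is null and only interior points matter.
    filter_upwards [hconv.ae_differentiableAt_of_mem_interior m,
      measure_eq_zero_iff_ae_notMem.1 (hconv.1.addHaar_frontier m)] with x hx hxf y hy
    have hxD : x ∈ interior (affineSupDomain A) := by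
      by_contra h
      exact hxf ⟨subset_closure (hdom _ hy), h⟩
    exact (gradient_eq_of_isSubgradient (mem_interior_iff_mem_nhds.1 hxD) (hx hxD)
      (hsub _ hy)).symm

end

theorem MeasureTheory.MemLp.integrable_real_inner {X E : Type*} [MeasurableSpace X]
    [NormedAddCommGroup E] [InnerProductSpace ℝ E] {ν : Measure X} {f g : X → E}
    (hf : MemLp f 2 ν) (hg : MemLp g 2 ν) : Integrable (fun x => ⟪f x, g x⟫) ν := by
  have hf2 := (memLp_two_iff_integrable_sq_norm hf.1).1 hf
  have hg2 := (memLp_two_iff_integrable_sq_norm hg.1).1 hg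
  refine (hf2.add hg2).mono' (hf.1.inner hg.1) (Eventually.of_forall fun x => ?_)
  have := norm_inner_le_norm (𝕜 := ℝ) (f x) (g x)
  simp only [Pi.add_apply]
  nlinarith [sq_nonneg (‖f x‖ - ‖g x‖), sq_nonneg (‖f x‖ + ‖g x‖)]

theorem CyclicallyMonotone.mono {E : Type*} [NormedAddCommGroup E] [InnerProductSpace ℝ E]
    {Γ Γ' : Set (E × E)} (h : CyclicallyMonotone Γ) (hΓ : Γ' ⊆ Γ) : CyclicallyMonotone Γ' :=
  fun n p hp => h n p fun i => hΓ (hp i)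

/-- Cyclical monotonicity of the graphs of maps passes to nonnegative combinations. -/
theorem CyclicallyMonotone.sum_smul {E ι : Type*} [NormedAddCommGroup E] [InnerProductSpace ℝ E]
    [Fintype ι] {s : Set E} {T : ι → E → E} {a : ι → ℝ} (ha : ∀ i, 0 ≤ a i)
    (h : ∀ i, CyclicallyMonotone ((fun x => (x, T i x)) '' s)) :
    CyclicallyMonotone ((fun x => (x, ∑ i, a i • T i x)) '' s) := by
  intro n p hp
  have hmem : ∀ k i, ((p k).1, T i (p k).1) ∈ (fun x => (x, T i x)) '' s := by
    intro k i
    obtain ⟨x, hx, hxp⟩ := hp k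
    exact ⟨x, hx, by rw [← hxp]⟩
  have h2 : ∀ k, (p k).2 = ∑ i, a i • T i (p k).1 := by
    intro k
    obtain ⟨x, hx, hxp⟩ := hp k
    rw [← hxp]
  simp only [h2, sum_inner, real_inner_smul_left]
  rw [Finset.sum_comm, ← Finset.sum_add_distrib]
  refine Finset.sum_nonpos fun i _ => ?_
  rw [← Finset.mul_sum, ← mul_add]
  exact mul_nonpos_of_nonneg_of_nonpos (ha i) (h i n (fun k => ((p k).1, T i (p k).1))
    fun k => hmem k i)

/-! ### Brenier's theorem and optimality by duality -/

section Brenier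

variable {E : Type*} [NormedAddCommGroup E] [InnerProductSpace ℝ E] [FiniteDimensional ℝ E]
  [MeasurableSpace E] [BorelSpace E] {ν μ : Measure E} [IsProbabilityMeasure ν]

/-- An optimal plan with absolutely continuous first marginal is concentrated on a graph. -/
theorem IsOptimalPlan.exists_map {π : Measure (E × E)} (h : IsOptimalPlan ν μ π)
    (hfin : planCost π ≠ ∞) {m : Measure E} [m.IsAddHaarMeasure] (hν : ν ≪ m) :
    ∃ T : E → E, Measurable T ∧ ∀ᵐ p ∂π, p.2 = T p.1 := by
  have := h.isProbabilityMeasure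
  obtain ⟨T, hT, hTm⟩ := (h.cyclicallyMonotone_support hfin).exists_measurable_map m
  refine ⟨T, hT, ?_⟩
  have h1 : ∀ᵐ p ∂π, ∀ y, (p.1, y) ∈ π.support → y = T p.1 := by
    have := hν.ae_le hTm
    rw [← h.fst_eq] at this
    exact ae_of_ae_map measurable_fst.aemeasurable this
  have h2 : ∀ᵐ p ∂π, p ∈ π.support := Measure.support_mem_ae
  filter_upwards [h1, h2] with p hp1 hp2 using hp1 p.2 hp2

/-- **Brenier's theorem**, existence part. -/
theorem exists_isOptimalPlan_graph [IsProbabilityMeasure μ] {m : Measure E} [m.IsAddHaarMeasure]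
    (hν : ν ≪ m) (hν2 : MemLp (fun x => x) 2 ν) (hμ2 : MemLp (fun x => x) 2 μ) :
    ∃ T : E → E, Measurable T ∧ ν.map T = μ ∧ IsOptimalPlan ν μ (ν.map fun x => (x, T x)) := by
  obtain ⟨π, h⟩ := exists_isOptimalPlan ν μ
  obtain ⟨T, hT, hTπ⟩ := h.exists_map (h.planCost_lt_top hν2 hμ2).ne hν
  have hπ : ν.map (fun x => (x, T x)) = π := by
    rw [← h.fst_eq, Measure.fst, Measure.map_map (by fun_prop) measurable_fst]
    conv_rhs => rw [← Measure.map_id (μ := π)]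
    refine Measure.map_congr ?_
    filter_upwards [hTπ] with p hp
    exact Prod.ext rfl hp.symm
  refine ⟨T, hT, ?_, hπ ▸ h⟩
  rw [← h.snd_eq, ← hπ, Measure.snd, Measure.map_map measurable_snd (by fun_prop)]
  rfl

/-- **Brenier's theorem**, uniqueness part. -/
theorem IsOptimalPlan.ae_eq_of_graph {m : Measure E} [m.IsAddHaarMeasure]
    (hν : ν ≪ m) {T S : E → E} (hT : Measurable T) (hS : Measurable S)
    (hTo : IsOptimalPlan ν μ (ν.map fun x => (x, T x)))
    (hSo : IsOptimalPlan ν μ (ν.map fun x => (x, S x)))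
    (hfin : planCost (ν.map fun x => (x, T x)) ≠ ∞) : T =ᵐ[ν] S := by
  let π₁ := ν.map fun x => (x, T x)
  let π₂ := ν.map fun x => (x, S x)
  have hcost : planCost π₂ = planCost π₁ :=
    le_antisymm (hSo.cost_le _ hTo.toIsCoupling) (hTo.cost_le _ hSo.toIsCoupling)
  have hhalf : ∀ ρ : Measure E, (2⁻¹ : ℝ≥0∞) • ρ + (2⁻¹ : ℝ≥0∞) • ρ = ρ := fun ρ => by
    rw [← add_smul, ENNReal.inv_two_add_inv_two, one_smul]
  -- The average of the two plans is again optimal, hence lies on a single graph, with which both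
  -- `T` and `S` must agree.
  have hcoup : IsCoupling ν μ ((2⁻¹ : ℝ≥0∞) • π₁ + (2⁻¹ : ℝ≥0∞) • π₂) := by
    constructor
    · rw [Measure.fst, Measure.map_add _ _ measurable_fst, Measure.map_smul, Measure.map_smul]
      change _ • π₁.fst + _ • π₂.fst = ν
      rw [hTo.fst_eq, hSo.fst_eq, hhalf]
    · rw [Measure.snd, Measure.map_add _ _ measurable_snd, Measure.map_smul, Measure.map_smul]
      change _ • π₁.snd + _ • π₂.snd = μ
      rw [hTo.snd_eq, hSo.snd_eq, hhalf]
  have hc : planCost ((2⁻¹ : ℝ≥0∞) • π₁ + (2⁻¹ : ℝ≥0∞) • π₂) = planCost π₁ := by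
    rw [planCost_add, planCost_smul, planCost_smul, hcost, ← add_mul,
      ENNReal.inv_two_add_inv_two, one_mul]
  have hopt : IsOptimalPlan ν μ ((2⁻¹ : ℝ≥0∞) • π₁ + (2⁻¹ : ℝ≥0∞) • π₂) :=
    ⟨hcoup, fun π' hπ' => hc.le.trans (hTo.cost_le π' hπ')⟩
  obtain ⟨R, hR, hRπ⟩ := hopt.exists_map (hc.trans_ne hfin) hν
  rw [ae_add_measure_iff, Measure.ae_ennreal_smul_measure_iff (by simp),
    Measure.ae_ennreal_smul_measure_iff (by simp)] at hRπ
  have h1 := ae_of_ae_map (by fun_prop) hRπ.1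
  have h2 := ae_of_ae_map (by fun_prop) hRπ.2
  filter_upwards [h1, h2] with x hx1 hx2 using hx1.trans hx2.symm

/-- The graph of an optimal plan induced by a map is cyclically monotone off a null set. -/
theorem IsOptimalPlan.exists_cyclicallyMonotone_graph {T : E → E} (hT : Measurable T)
    (h : IsOptimalPlan ν μ (ν.map fun x => (x, T x)))
    (hfin : planCost (ν.map fun x => (x, T x)) ≠ ∞) :
    ∃ s : Set E, (∀ᵐ x ∂ν, x ∈ s) ∧ CyclicallyMonotone ((fun x => (x, T x)) '' s) := by
  have := h.isProbabilityMeasure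
  refine ⟨{x | (x, T x) ∈ (ν.map fun x => (x, T x)).support}, ?_, ?_⟩
  · exact ae_of_ae_map (f := fun x => (x, T x)) (by fun_prop) Measure.support_mem_ae
  · refine (h.cyclicallyMonotone_support hfin).mono ?_
    rintro _ ⟨x, hx, rfl⟩
    exact hx

-- Let `φ` be the Rockafellar potential and `ψ` its conjugate. Then `⟪x, y⟫ ≤ φ x + ψ y`, with
-- equality at `y = T x`, and `ψ ∘ S`, `ψ ∘ T` have equal integrals because `S` and `T` have the
-- same law.
omit [FiniteDimensional ℝ E] in
theorem CyclicallyMonotone.integral_inner_le [SecondCountableTopology E] {T S : E → E} {s : Set E}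
    (hcm : CyclicallyMonotone ((fun x => (x, T x)) '' s)) (hs : ∀ᵐ x ∂ν, x ∈ s)
    (hT : Measurable T) (hS : Measurable S) (hTS : ν.map S = ν.map T)
    (hν2 : MemLp (fun x => x) 2 ν) (hT2 : MemLp T 2 ν) (hS2 : MemLp S 2 ν) :
    ∫ x, ⟪x, S x⟫ ∂ν ≤ ∫ x, ⟪x, T x⟫ ∂ν := by
  obtain ⟨x₀, hx₀⟩ : s.Nonempty := hs.exists
  obtain ⟨A, ⟨f, hf⟩, hdom, hsub⟩ := hcm.exists_affineSup ⟨_, mem_image_of_mem _ hx₀⟩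
  have hneA : Nonempty A := ⟨⟨f, hf⟩⟩
  let D := affineSupDomain A
  let φ := affineSup A
  have hdom' : ∀ x ∈ s, x ∈ D := fun x hx => hdom _ (mem_image_of_mem _ hx)
  have hsub' : ∀ x ∈ s, ∀ z ∈ D, φ x + ⟪T x, z - x⟫ ≤ φ z := fun x hx =>
    hsub _ (mem_image_of_mem _ hx)
  have hneD : Nonempty D := ⟨⟨x₀, hdom' x₀ hx₀⟩⟩
  let g : D → E → ℝ := fun z y => ⟪y, z.1⟫ - φ z
  have hg : ∀ z, Continuous (g z) := fun z => by fun_prop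
  let B : Set E := {y | BddAbove (range fun z => g z y)}
  have hB : MeasurableSet B := measurableSet_bddAbove_range_of_continuous hg
  let ψ : E → ℝ := fun y => ⨆ z, g z y
  have hψ : Measurable ψ := measurable_iSup_of_continuous hg
  have hφ : Measurable φ := measurable_iSup_of_continuous fun f : A => by fun_prop
  have hgT : ∀ x ∈ s, ∀ z, g z (T x) ≤ ⟪x, T x⟫ - φ x := by
    intro x hx z
    have := hsub' x hx z z.2
    simp only [g, inner_sub_right, real_inner_comm x (T x)] at this ⊢
    linarith
  have hTB : ∀ x ∈ s, T x ∈ B := fun x hx => ⟨_, forall_mem_range.2 (hgT x hx)⟩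
  have hψT : ∀ x ∈ s, ψ (T x) = ⟪x, T x⟫ - φ x := by
    intro x hx
    refine le_antisymm (ciSup_le (hgT x hx)) ?_
    have := le_ciSup (hTB x hx) ⟨x, hdom' x hx⟩
    rwa [show g ⟨x, hdom' x hx⟩ (T x) = ⟪x, T x⟫ - φ x by
      simp only [g, real_inner_comm]] at this
  -- Outside `B` the real supremum `ψ` takes the default value `0` and the duality inequality may
  -- fail; equality of laws keeps `S` in `B`.
  have hSB : ∀ᵐ x ∂ν, S x ∈ B := by
    refine ae_of_ae_map hS.aemeasurable (p := fun y => y ∈ B) ?_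
    rw [hTS]
    refine (ae_map_iff hT.aemeasurable hB).2 ?_
    filter_upwards [hs] with x hx using hTB x hx
  have hiT : Integrable (fun x => ⟪x, T x⟫) ν := hν2.integrable_real_inner hT2
  have hiS : Integrable (fun x => ⟪x, S x⟫) ν := hν2.integrable_real_inner hS2
  -- A member of `A` bounds `φ` below; the subgradient inequality tested at `x₀` bounds it above.
  have hφi : Integrable φ ν := by
    refine integrable_of_le_of_le (g₁ := fun x => ⟪f.1, x⟫ + f.2)
      (g₂ := fun x => ⟪x, T x⟫ - (⟪T x, x₀⟫ - φ x₀)) hφ.aestronglyMeasurable ?_ ?_ ?_ ?_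
    · filter_upwards [hs] with x hx using le_affineSup (hdom' x hx) hf
    · filter_upwards [hs] with x hx
      have := hgT x hx ⟨x₀, hdom' x₀ hx₀⟩
      simp only [g] at this
      linarith
    · exact ((hν2.const_inner f.1).integrable (by norm_num)).add (integrable_const _)
    · exact hiT.sub (((hT2.inner_const x₀).integrable (by norm_num)).sub (integrable_const _))
  have hψTi : Integrable (fun x => ψ (T x)) ν := by
    refine (hiT.sub hφi).congr ?_
    filter_upwards [hs] with x hx using (hψT x hx).symm
  have hψρ : Integrable ψ (ν.map S) := by
    rw [hTS]
    exact (integrable_map_measure hψ.aestronglyMeasurable hT.aemeasurable).2 hψTi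
  have hψSi : Integrable (fun x => ψ (S x)) ν :=
    (integrable_map_measure hψ.aestronglyMeasurable hS.aemeasurable).1 hψρ
  have hψint : ∫ x, ψ (S x) ∂ν = ∫ x, ψ (T x) ∂ν := by
    rw [← integral_map hS.aemeasurable hψ.aestronglyMeasurable, hTS,
      integral_map hT.aemeasurable hψ.aestronglyMeasurable]
  calc ∫ x, ⟪x, S x⟫ ∂ν ≤ ∫ x, (φ x + ψ (S x)) ∂ν := by
        refine integral_mono_ae hiS (hφi.add hψSi) ?_
        filter_upwards [hs, hSB] with x hx hxB
        have := le_ciSup hxB ⟨x, hdom' x hx⟩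
        simp only [g, real_inner_comm x] at this
        change ⟪x, S x⟫ ≤ φ x + ψ (S x)
        change _ ≤ ψ (S x) at this
        linarith
    _ = ∫ x, φ x + ψ (T x) ∂ν := by
        rw [integral_add hφi hψSi, integral_add hφi hψTi, hψint]
    _ = ∫ x, ⟪x, T x⟫ ∂ν := by
        refine integral_congr_ae ?_
        filter_upwards [hs] with x hx
        rw [hψT x hx]
        ring

end Brenier

/-- Expand both sides in inner products; the diagonal terms vanish, so the restriction `i ≠ j` is
harmless. -/
theorem norm_sum_smul_sq {E ι : Type*} [NormedAddCommGroup E] [InnerProductSpace ℝ E] [Fintype ι]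
    [DecidableEq ι] (a : ι → ℝ) (ha : ∑ i, a i = 1) (u : ι → E) :
    ‖∑ i, a i • u i‖ ^ 2 = ∑ i, a i * ‖u i‖ ^ 2
      - 1 / 2 * ∑ i, ∑ j ∈ Finset.univ.filter (fun j => i ≠ j), a i * a j * ‖u i - u j‖ ^ 2 := by
  have h1 : ∀ i, ∑ j ∈ Finset.univ.filter (fun j => i ≠ j), a i * a j * ‖u i - u j‖ ^ 2 =
      ∑ j, a i * a j * ‖u i - u j‖ ^ 2 := fun i => by
    refine Finset.sum_subset (Finset.filter_subset _ _) fun j _ hj => ?_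
    have : i = j := by simpa using hj
    simp [this]
  have h2 : ∀ i j, a i * a j * ‖u i - u j‖ ^ 2 = a i * ‖u i‖ ^ 2 * a j
      + a i * (a j * ‖u j‖ ^ 2) - 2 * (a i * (a j * ⟪u i, u j⟫)) := fun i j => by
    rw [norm_sub_sq_real]
    ring
  have h3 : ‖∑ i, a i • u i‖ ^ 2 = ∑ i, ∑ j, a i * (a j * ⟪u i, u j⟫) := by
    rw [← real_inner_self_eq_norm_sq, sum_inner]
    simp only [inner_sum, real_inner_smul_left, real_inner_smul_right]
    exact Finset.sum_congr rfl fun i _ => Finset.sum_congr rfl fun j _ => by ring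
  rw [Finset.sum_congr rfl fun i _ => h1 i]
  simp only [h2, Finset.sum_add_distrib, Finset.sum_sub_distrib, ← Finset.mul_sum, ha,
    ← Finset.sum_mul, mul_one, one_mul] at h3 ⊢
  rw [h3]
  ring

/-! ### From optimal plans to optimal maps -/

section OptimalMap

variable {d : ℕ} {ν μ : Measure (EuclideanSpace ℝ (Fin d))}
  {T : EuclideanSpace ℝ (Fin d) → EuclideanSpace ℝ (Fin d)}

theorem inP2_map_iff [IsProbabilityMeasure ν] (hT : Measurable T) :
    InP2 (ν.map T) ↔ MemLp T 2 ν := by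
  have h := memLp_map_measure_iff (p := 2) (μ := ν) (f := T) (g := fun x => x)
    aestronglyMeasurable_id hT.aemeasurable
  exact ⟨fun h' => h.1 h'.2, fun h' => ⟨Measure.isProbabilityMeasure_map hT.aemeasurable, h.2 h'⟩⟩

theorem mongeCost_eq_planCost (hT : Measurable T) :
    mongeCost ν T = planCost (ν.map fun x => (x, T x)) :=
  (planCost_graph hT).symm

theorem IsOptimalPlan.isOptimalMap (hT : Measurable T) (hmap : ν.map T = μ)
    (h : IsOptimalPlan ν μ (ν.map fun x => (x, T x))) : IsOptimalMap ν μ T := by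
  refine ⟨hT, hmap, fun S hS hSmap => ?_⟩
  rw [mongeCost_eq_planCost hT, mongeCost_eq_planCost hS]
  exact h.cost_le _ (isCoupling_graph hS hSmap)

/-- Brenier's theorem provides an optimal plan carried by a graph, so minimality among maps is
already minimality among plans. -/
theorem IsOptimalMap.isOptimalPlan (hT : IsOptimalMap ν μ T) (hν : InP2 ν) (hμ : InP2 μ)
    (hac : ν ≪ volume) : IsOptimalPlan ν μ (ν.map fun x => (x, T x)) := by
  have := hν.1
  have := hμ.1
  obtain ⟨S, hS, hSmap, hSo⟩ := exists_isOptimalPlan_graph hac hν.2 hμ.2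
  refine ⟨isCoupling_graph hT.measurable hT.map_eq, fun π' hπ' => le_trans ?_ (hSo.cost_le π' hπ')⟩
  rw [← mongeCost_eq_planCost hT.measurable, ← mongeCost_eq_planCost hS]
  exact hT.cost_le S hS hSmap

theorem hasUniqueOptimalMap (hν : InP2 ν) (hμ : InP2 μ) (hac : ν ≪ volume) :
    HasUniqueOptimalMap ν μ := by
  have := hν.1
  have := hμ.1
  refine ⟨?_, fun T S hT hS => ?_⟩
  · obtain ⟨T, hT, hmap, h⟩ := exists_isOptimalPlan_graph hac hν.2 hμ.2
    exact ⟨T, h.isOptimalMap hT hmap⟩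
  · have hTo := hT.isOptimalPlan hν hμ hac
    exact hTo.ae_eq_of_graph hac hT.measurable hS.measurable (hS.isOptimalPlan hν hμ hac)
      (hTo.planCost_lt_top hν.2 hμ.2).ne

theorem isOptimalMap_optimalMap (h : HasUniqueOptimalMap ν μ) :
    IsOptimalMap ν μ (optimalMap ν μ) :=
  Classical.epsilon_spec h.1

theorem IsOptimalMap.exists_cyclicallyMonotone (hT : IsOptimalMap ν μ T) (hν : InP2 ν)
    (hμ : InP2 μ) (hac : ν ≪ volume) :
    ∃ s, (∀ᵐ x ∂ν, x ∈ s) ∧ CyclicallyMonotone ((fun x => (x, T x)) '' s) := by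
  have := hν.1
  have hTo := hT.isOptimalPlan hν hμ hac
  exact hTo.exists_cyclicallyMonotone_graph hT.measurable (hTo.planCost_lt_top hν.2 hμ.2).ne

theorem isOptimalMap_id : IsOptimalMap ν ν id := by
  refine ⟨measurable_id, Measure.map_id, fun S _ _ => ?_⟩
  simp [mongeCost]

/-- The second moments depend only on the two marginals, so lowering the cost means raising `∫ ⟪x, T
x⟫`. -/
theorem mongeCost_eq_ofReal [IsProbabilityMeasure ν] (hν : MemLp (fun x => x) 2 ν)
    (hT : Measurable T) (hT2 : MemLp T 2 ν) :
    mongeCost ν T = ENNReal.ofReal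
      (∫ x, ‖x‖ ^ 2 ∂ν + ∫ x, ‖x‖ ^ 2 ∂(ν.map T) - 2 * ∫ x, ⟪x, T x⟫ ∂ν) := by
  have hi := (memLp_two_iff_integrable_sq_norm hν.1).1 hν
  have hiT := (memLp_two_iff_integrable_sq_norm hT2.1).1 hT2
  have hiI := hν.integrable_real_inner hT2
  have hsub : Integrable (fun x => ‖x - T x‖ ^ 2) ν :=
    (memLp_two_iff_integrable_sq_norm (hν.sub hT2).1).1 (hν.sub hT2)
  rw [integral_map hT.aemeasurable (by fun_prop), ← integral_add hi hiT, ← integral_const_mul,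
    ← integral_sub (f := fun x => ‖x‖ ^ 2 + ‖T x‖ ^ 2) (hi.add hiT) (hiI.const_mul 2)]
  have : ∀ x, ‖x‖ ^ 2 + ‖T x‖ ^ 2 - 2 * ⟪x, T x⟫ = ‖x - T x‖ ^ 2 := fun x => by
    rw [norm_sub_sq_real]
    ring
  simp only [this]
  rw [ofReal_integral_eq_lintegral_ofReal hsub (Eventually.of_forall fun x => by positivity)]
  refine lintegral_congr fun x => ?_
  rw [ENNReal.ofReal_pow (norm_nonneg _), ofReal_norm]

/-- A square-integrable map with cyclically monotone graph is optimal. -/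
theorem CyclicallyMonotone.isOptimalMap (hν : InP2 ν) (hT : Measurable T) (hT2 : MemLp T 2 ν)
    {s : Set (EuclideanSpace ℝ (Fin d))} (hs : ∀ᵐ x ∂ν, x ∈ s)
    (hcm : CyclicallyMonotone ((fun x => (x, T x)) '' s)) : IsOptimalMap ν (ν.map T) T := by
  have := hν.1
  refine ⟨hT, rfl, fun S hS hST => ?_⟩
  have hS2 : MemLp S 2 ν := (inP2_map_iff hS).1 (hST ▸ (inP2_map_iff hT).2 hT2)
  rw [mongeCost_eq_ofReal hν.2 hT hT2, mongeCost_eq_ofReal hν.2 hS hS2, hST]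
  refine ENNReal.ofReal_le_ofReal ?_
  linarith [hcm.integral_inner_le hs hT hS hST hν.2 hT2 hS2]

theorem transportMetric_sq (μ₁ μ₂ : Measure (EuclideanSpace ℝ (Fin d))) :
    transportMetric ν μ₁ μ₂ ^ 2 = ∫ x, ‖optimalMap ν μ₁ x - optimalMap ν μ₂ x‖ ^ 2 ∂ν :=
  Real.sq_sqrt (integral_nonneg fun _ => by positivity)

end OptimalMap

/-! ### The generalized geodesic -/

theorem proposition1 {d m : ℕ}
    (ν : Measure (EuclideanSpace ℝ (Fin d))) (hν : InP2 ν) (hν_ac : ν ≪ volume)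
    (μ : Fin m → Measure (EuclideanSpace ℝ (Fin d))) (hμ : ∀ i, InP2 (μ i))
    (a : Fin m → ℝ) (ha : a ∈ stdSimplex ℝ (Fin m)) :
    HasUniqueOptimalMap ν ν ∧
    (∀ i, HasUniqueOptimalMap ν (μ i)) ∧
    InP2 (generalizedGeodesic ν μ a) ∧
    HasUniqueOptimalMap ν (generalizedGeodesic ν μ a) ∧
    IsOptimalMap ν (generalizedGeodesic ν μ a) (combinedMap ν μ a) ∧
    transportMetric ν (generalizedGeodesic ν μ a) ν ^ 2 =
      ∑ i, a i * transportMetric ν (μ i) ν ^ 2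
        - 1 / 2 * ∑ i, ∑ j ∈ Finset.univ.filter (fun j => i ≠ j),
            a i * a j * transportMetric ν (μ i) (μ j) ^ 2 := by
  have := hν.1
  have hνu := hasUniqueOptimalMap hν hν hν_ac
  have hμu := fun i => hasUniqueOptimalMap hν (hμ i) hν_ac
  have hopt := fun i => isOptimalMap_optimalMap (hμu i)
  have hL2 : ∀ i, MemLp (optimalMap ν (μ i)) 2 ν := fun i =>
    (inP2_map_iff (hopt i).measurable).1 (by rw [(hopt i).map_eq]; exact hμ i)
  have hcm_meas : Measurable (combinedMap ν μ a) :=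
    Finset.measurable_fun_sum _ fun i _ => (hopt i).measurable.const_smul (a i)
  have hc2 : MemLp (combinedMap ν μ a) 2 ν :=
    memLp_finsetSum _ fun i _ => (hL2 i).const_smul (a i)
  have hgeo : InP2 (generalizedGeodesic ν μ a) := (inP2_map_iff hcm_meas).2 hc2
  have hgu := hasUniqueOptimalMap hν hgeo hν_ac
  choose s hs hscm using fun i => (hopt i).exists_cyclicallyMonotone hν (hμ i) hν_ac
  have hcomb : IsOptimalMap ν (generalizedGeodesic ν μ a) (combinedMap ν μ a) := by
    refine CyclicallyMonotone.isOptimalMap hν hcm_meas hc2 (s := ⋂ i, s i) ?_ ?_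
    · filter_upwards [ae_all_iff.2 hs] with x hx using mem_iInter.2 hx
    · exact CyclicallyMonotone.sum_smul ha.1 fun i =>
        (hscm i).mono (image_mono (iInter_subset s i))
  refine ⟨hνu, hμu, hgeo, hgu, hcomb, ?_⟩
  -- This serves only to make `optimalMap ν ν` square integrable.
  have hid : optimalMap ν ν =ᵐ[ν] id := hνu.2 _ _ (isOptimalMap_optimalMap hνu) isOptimalMap_id
  have hceq : optimalMap ν (generalizedGeodesic ν μ a) =ᵐ[ν] combinedMap ν μ a :=
    hgu.2 _ _ (isOptimalMap_optimalMap hgu) hcomb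
  have hν2 : MemLp (optimalMap ν ν) 2 ν := hν.2.ae_eq hid.symm
  have hint : ∀ i, Integrable (fun x => ‖optimalMap ν (μ i) x - optimalMap ν ν x‖ ^ 2) ν :=
    fun i => (memLp_two_iff_integrable_sq_norm ((hL2 i).sub hν2).1).1 ((hL2 i).sub hν2)
  have hint2 : ∀ i j,
      Integrable (fun x => ‖optimalMap ν (μ i) x - optimalMap ν (μ j) x‖ ^ 2) ν :=
    fun i j => (memLp_two_iff_integrable_sq_norm ((hL2 i).sub (hL2 j)).1).1 ((hL2 i).sub (hL2 j))
  simp only [transportMetric_sq, ← integral_const_mul]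
  rw [← integral_finsetSum _ fun i _ => (hint i).const_mul (a i)]
  simp only [← integral_finsetSum _ fun j _ => (hint2 _ j).const_mul _]
  rw [← integral_finsetSum _ fun i _ => integrable_finsetSum _ fun j _ =>
    (hint2 i j).const_mul _, ← integral_const_mul, ← integral_sub]
  · refine integral_congr_ae ?_
    filter_upwards [hceq] with x hx
    -- The weights sum to one, so the common base map can be pulled out of the combination and
    -- cancels in the differences.
    have := norm_sum_smul_sq a ha.2 fun i => optimalMap ν (μ i) x - optimalMap ν ν x
    simp only [sub_sub_sub_cancel_right, smul_sub, Finset.sum_sub_distrib, ← Finset.sum_smul,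
      ha.2, one_smul] at this
    rw [hx]
    exact this
  · exact integrable_finsetSum _ fun i _ => (hint i).const_mul (a i)
  · exact (integrable_finsetSum _ fun i _ => integrable_finsetSum _ fun j _ =>
      (hint2 i j).const_mul _).const_mul _
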